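/- Let $p$ be a prime and let $G$ be a finite nonabelian $p$-group with center $\mathbf{Z}(G)$. Let $\mathcal{C}(G)$ be the set of all subgroups of $G$ of the form $\mathbf{C}_G(H)$ with $H \le G$, and let $\mathcal{CD}(G)$ be the set of all subgroups $H \le G$ for which $m_G(H) = |H|\cdot|\mathbf{C}_G(H)|$ attains its maximum over all subgroups of $G$; both are ordered by inclusion. A partially ordered set is called a quasi-antichain if it consists of a maximum, a minimum, and atoms (elements covering the minimum); such an ordered set is a lattice. A subgroup $A \le G$ is called maximal abelian if it is abelian and $A = \mathbf{C}_G(A)$. Then $\mathcal{C}(G) = \mathcal{CD}(G)$ and this lattice is a quasi-antichain if and only if the following all hold, for some non-negative integer $w$ and some pairwise distinct subgroups $A_1,\dots,A_w$ of $G$: 1. $G$ is nilpotent of class exactly $2$; 2. $\mathcal{C}(G) = \{G, A_1, \dots, A_w, \mathbf{Z}(G)\}$, where each $A_i$ is a maximal abelian subgroup of $G$ of order $|A_i| = \sqrt{|G|\,|\mathbf{Z}(G)|}$; 3. there exist positive integers $a, b$ with $b \le a$ such that $|G/\mathbf{Z}(G)| = p^{2a}$ and $w = p^b + 1$. -/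

import Mathlib

namespace ChermakDelgado

/-- The Chermak--Delgado measure `m_G(H) = |H| * |C_G(H)|` of a subgroup `H` of `G`. -/
noncomputable def measure {G : Type*} [Group G] (H : Subgroup G) : ℕ :=
  Nat.card H * Nat.card (Subgroup.centralizer (H : Set G))

/-- The Chermak--Delgado lattice `CD(G)`: the set of subgroups of maximal measure,
ordered by inclusion. -/
def cdLattice (G : Type*) [Group G] : Set (Subgroup G) :=
  {H | ∀ K : Subgroup G, measure K ≤ measure H}

/-- The centralizer lattice `C(G)`: the set of subgroups of `G` that are centralizers of
subgroups of `G`, ordered by inclusion. -/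
def centralizerLattice (G : Type*) [Group G] : Set (Subgroup G) :=
  {C | ∃ H : Subgroup G, C = Subgroup.centralizer (H : Set G)}

/-- A partially ordered set is a quasi-antichain if it consists of a minimum, a maximum, and
atoms (elements covering the minimum). Such an ordered set is automatically a lattice: two
distinct atoms have the minimum as infimum and the maximum as supremum. -/
def IsQuasiAntichain (L : Type*) [PartialOrder L] : Prop :=
  ∃ b t : L, IsBot b ∧ IsTop t ∧ ∀ x : L, x = b ∨ x = t ∨ b ⋖ x

/-- An abelian subgroup `A` of `G` is maximal abelian (self-centralizing) if `A = C_G(A)`. -/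
def IsMaximalAbelian {G : Type*} [Group G] (A : Subgroup G) : Prop :=
  (∀ x ∈ A, ∀ y ∈ A, x * y = y * x) ∧ A = Subgroup.centralizer (A : Set G)

/-- `G` is nilpotent of nilpotency class `n`. -/
def IsNilpotentOfClass (G : Type*) [Group G] (n : ℕ) : Prop :=
  ∃ _ : Group.IsNilpotent G, Group.nilpotencyClass G = n

end ChermakDelgado

namespace ChermakDelgado

open Subgroup
open scoped commutatorElement

variable {G : Type*} [Group G]

/-! For noncentral `x`, the double centralizer of `x` lies in `C(x)` and contains `x`, so the
quasi-antichain condition forces the two to coincide. Thus the `C(x)` are abelian, distinct ones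
meet in `Z`, and constant measure gives `|C(x)|² = |G||Z|`. Two distinct ones therefore have product
`G`. A proper subgroup times a conjugate of it is never `G`, so each `C(x)` is normal and
commutators fall into `Z`. With `|G/Z| = q²`, counting noncentral elements gives `q + 1` such
subgroups. Conversely, the given orders make the measure constant on centralizers and rule out
inclusions among the `A_i`. -/

theorem exists_mul_eq_of_card_mul_card [Finite G] {A B : Subgroup G}
    (h : Nat.card A * Nat.card B = Nat.card G * Nat.card (A ⊓ B : Subgroup G)) (g : G) :
    ∃ a ∈ A, ∃ b ∈ B, g = a * b := by
  -- Cosets of `A ⊓ B` in `A` embed into cosets of `B` in `G`; the order hypothesis makes the two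
  -- sets equinumerous, so every coset of `B` meets `A`.
  let f : A ⧸ B.subgroupOf A → G ⧸ B :=
    Quotient.map' (fun a => (a : G)) fun a b hab => by
      rw [QuotientGroup.leftRel_apply] at hab ⊢
      simpa [mem_subgroupOf] using hab
  have hinj : Function.Injective f := by
    intro x y
    induction x using QuotientGroup.induction_on
    induction y using QuotientGroup.induction_on
    intro hxy
    have := QuotientGroup.eq.1 hxy
    exact QuotientGroup.eq.2 (by simpa [mem_subgroupOf] using this)
  have hcard : Nat.card (A ⧸ B.subgroupOf A) = Nat.card (G ⧸ B) := by
    have h1 := card_eq_card_quotient_mul_card_subgroup (B.subgroupOf A)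
    have h2 := card_eq_card_quotient_mul_card_subgroup B
    have h3 : Nat.card (B.subgroupOf A) = Nat.card (A ⊓ B : Subgroup G) := by
      rw [← inf_subgroupOf_left]
      exact Nat.card_congr (subgroupOfEquivOfLe inf_le_left).toEquiv
    rw [h3] at h1
    rw [h1, h2] at h
    have hA : 0 < Nat.card (A ⊓ B : Subgroup G) := Nat.card_pos
    have hB : 0 < Nat.card B := Nat.card_pos
    apply Nat.eq_of_mul_eq_mul_right (Nat.mul_pos hA hB)
    linarith
  have hbij := (Nat.bijective_iff_injective_and_card f).2 ⟨hinj, hcard⟩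
  obtain ⟨x, hx⟩ := hbij.2 (g : G ⧸ B)
  induction x using QuotientGroup.induction_on with
  | H a => exact ⟨a, a.2, _, QuotientGroup.eq.1 hx, by simp⟩

/-- The equation collapses to `a * g * b = 1`. This is why a proper subgroup times its conjugate
cannot be the whole group. -/
theorem mem_of_inv_eq_mul_conj {A : Subgroup G} {g a b : G} (ha : a ∈ A) (hb : b ∈ A)
    (h : g⁻¹ = a * (g * b * g⁻¹)) : g ∈ A := by
  have h' : a * g * b = 1 := by
    have := congrArg (· * g) h
    simpa [mul_assoc] using this.symm
  have hg : g = a⁻¹ * b⁻¹ := by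
    rw [← mul_inv_rev, eq_inv_iff_mul_eq_one, ← mul_assoc]
    have := congrArg (fun t => a⁻¹ * t * a) h'
    simpa [mul_assoc] using this
  rw [hg]
  exact A.mul_mem (A.inv_mem ha) (A.inv_mem hb)

theorem centralizer_mem (s : Set G) : centralizer s ∈ centralizerLattice G :=
  ⟨closure s, by rw [centralizer_closure]⟩

theorem top_mem : (⊤ : Subgroup G) ∈ centralizerLattice G :=
  ⟨⊥, by ext; simp [mem_centralizer_iff]⟩

theorem center_mem : center G ∈ centralizerLattice G :=
  ⟨⊤, by rw [coe_top, centralizer_univ]⟩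

theorem measure_top : measure (⊤ : Subgroup G) = Nat.card G * Nat.card (center G) := by
  rw [measure, coe_top, centralizer_univ, card_top]

theorem le_centralizer_centralizer (s : Set G) : s ⊆ centralizer (centralizer s : Set G) :=
  Set.subset_centralizer_centralizer

theorem centralizer_centralizer_centralizer (s : Set G) :
    centralizer (centralizer (centralizer s : Set G) : Set G) = centralizer s :=
  SetLike.coe_injective (Set.centralizer_centralizer_centralizer s)

theorem mem_centralizer_singleton_self (x : G) : x ∈ centralizer ({x} : Set G) := by
  simp [mem_centralizer_iff]

theorem centralizer_singleton_eq_top {x : G} : centralizer ({x} : Set G) = ⊤ ↔ x ∈ center G := by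
  rw [centralizer_eq_top_iff_subset]; simp

/-- The element centralizers of noncentral elements are self-centralizing, two of them meet only
in the center, and they all have order `√(|G| |Z(G)|)`. -/
structure HasCentralizerSpread (G : Type*) [Group G] : Prop where
  self_centralizing : ∀ x ∉ center G,
    centralizer (centralizer ({x} : Set G) : Set G) = centralizer {x}
  eq_of_mem : ∀ x, ∀ y ∈ centralizer ({x} : Set G), x ∉ center G → y ∉ center G →
    centralizer {y} = centralizer ({x} : Set G)
  card_sq : ∀ x ∉ center G, Nat.card (centralizer ({x} : Set G)) *
    Nat.card (centralizer ({x} : Set G)) = Nat.card G * Nat.card (center G)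

/-! ### Groups whose element centralizers meet only in the center -/

namespace HasCentralizerSpread

theorem commute (h : HasCentralizerSpread G) {x u v : G} (hx : x ∉ center G)
    (hu : u ∈ centralizer ({x} : Set G)) (hv : v ∈ centralizer ({x} : Set G)) : u * v = v * u := by
  rw [← h.self_centralizing x hx] at hv
  exact mem_centralizer_iff.1 hv u hu

theorem inf_eq_center (h : HasCentralizerSpread G) {x y : G} (hx : x ∉ center G)
    (hy : y ∉ center G) (hxy : y ∉ centralizer ({x} : Set G)) :
    centralizer ({x} : Set G) ⊓ centralizer {y} = center G := by
  refine le_antisymm (fun z hz => ?_) (le_inf (center_le_centralizer _) (center_le_centralizer _))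
  by_contra hzc
  apply hxy
  rw [← h.eq_of_mem x z hz.1 hx hzc, h.eq_of_mem y z hz.2 hy hzc]
  exact mem_centralizer_singleton_self y

theorem exists_mul_eq [Finite G] (h : HasCentralizerSpread G) {x y : G} (hx : x ∉ center G)
    (hy : y ∉ center G) (hxy : y ∉ centralizer ({x} : Set G)) (g : G) :
    ∃ a ∈ centralizer ({x} : Set G), ∃ b ∈ centralizer ({y} : Set G), g = a * b := by
  apply exists_mul_eq_of_card_mul_card
  rw [h.inf_eq_center hx hy hxy, ← h.card_sq x hx]
  congr 1
  have := (h.card_sq x hx).trans (h.card_sq y hy).symm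
  exact (Nat.mul_self_inj.1 this).symm

theorem normal [Finite G] (h : HasCentralizerSpread G) {x : G} (hx : x ∉ center G) :
    (centralizer ({x} : Set G)).Normal := by
  have conj_mem : ∀ y n g : G, n ∈ centralizer ({y} : Set G) →
      g * n * g⁻¹ ∈ centralizer ({g * y * g⁻¹} : Set G) := by
    intro y n g hn
    rw [mem_centralizer_singleton_iff] at hn ⊢
    simpa using congrArg (fun t => g * t * g⁻¹) hn
  refine ⟨fun n hn g => ?_⟩
  have hgx : g * x * g⁻¹ ∉ center G := fun hc => hx <| by
    simpa [mul_assoc] using (inferInstance : (center G).Normal).conj_mem _ hc g⁻¹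
  by_cases hm : g * x * g⁻¹ ∈ centralizer ({x} : Set G)
  · rw [← h.eq_of_mem x _ hm hx hgx]
    exact conj_mem x n g hn
  · exfalso
    -- Factoring the conjugator's inverse itself puts `g` in `C(x)`, hence also `g * x * g⁻¹`.
    obtain ⟨a, ha, b, hb, hab⟩ := h.exists_mul_eq hx hgx hm g⁻¹
    have hb' : g⁻¹ * b * g ∈ centralizer ({x} : Set G) := by
      simpa [mul_assoc] using conj_mem _ b g⁻¹ hb
    have hg := mem_of_inv_eq_mul_conj (g := g) ha hb' (by simpa [mul_assoc] using hab)
    exact hm (mul_mem (mul_mem hg (mem_centralizer_singleton_self x)) (inv_mem hg))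

theorem commutator_mem_center [Finite G] (h : HasCentralizerSpread G) (u v : G) :
    ⁅u, v⁆ ∈ center G := by
  by_cases hx : u ∈ center G
  · have : ⁅u, v⁆ = 1 := commutatorElement_eq_one_iff_mul_comm.2 (mem_center_iff.1 hx v).symm
    rw [this]; exact one_mem _
  by_cases hv : v ∈ centralizer ({u} : Set G)
  · have : ⁅u, v⁆ = 1 := commutatorElement_eq_one_iff_mul_comm.2
      (h.commute hx (mem_centralizer_singleton_self u) hv)
    rw [this]; exact one_mem _
  have hy : v ∉ center G := fun hc => hv (center_le_centralizer _ hc)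
  have := h.normal hx
  have := h.normal hy
  rw [← h.inf_eq_center hx hy hv]
  exact commutator_le_inf _ _ (commutator_mem_commutator (mem_centralizer_singleton_self u)
    (mem_centralizer_singleton_self v))

theorem isNilpotentOfClass_two [Finite G] (h : HasCentralizerSpread G)
    (hnonab : ∃ x y : G, x * y ≠ y * x) : IsNilpotentOfClass G 2 := by
  have htop : Subgroup.upperCentralSeries G 2 = ⊤ := by
    rw [eq_top_iff]
    intro u _
    rw [Subgroup.mem_upperCentralSeries_succ_iff]
    intro v
    rw [Subgroup.upperCentralSeries_one]
    exact h.commutator_mem_center u v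
  have hnil : Group.IsNilpotent G := ⟨2, htop⟩
  refine ⟨hnil, le_antisymm (Subgroup.upperCentralSeries_eq_top_iff_nilpotencyClass_le.1 htop) ?_⟩
  by_contra hlt
  have h1 : Subgroup.upperCentralSeries G 1 = ⊤ :=
    Subgroup.upperCentralSeries_eq_top_iff_nilpotencyClass_le.2 (by omega)
  rw [Subgroup.upperCentralSeries_one] at h1
  obtain ⟨x, y, hxy⟩ := hnonab
  exact hxy (mem_center_iff.1 (h1 ▸ mem_top y) x)

/-- The map `x ↦ C(x)` partitions the noncentral elements, the fibre over `A` being `A` minus the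
center. -/
theorem card_mul_sub [Finite G] (h : HasCentralizerSpread G) {n : ℕ}
    (hn : n * n = Nat.card G * Nat.card (center G)) :
    Nat.card G - Nat.card (center G) =
      Nat.card {A : Subgroup G | ∃ x ∉ center G, A = centralizer {x}} *
        (n - Nat.card (center G)) := by
  classical
  have := Fintype.ofFinite G
  have := Fintype.ofFinite (Subgroup G)
  have hfin : ∀ A : Subgroup G, Nat.card A = (Finset.univ.filter (· ∈ A)).card := fun A => by
    rw [Nat.card_eq_fintype_card, Fintype.card_subtype]
  let s : Finset G := Finset.univ.filter (· ∉ center G)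
  let t : Finset (Subgroup G) := Finset.univ.filter fun A => ∃ x ∉ center G, A = centralizer {x}
  have ht : Nat.card {A : Subgroup G | ∃ x ∉ center G, A = centralizer {x}} = t.card := by
    rw [Nat.card_eq_fintype_card]
    exact Fintype.card_subtype _
  have hs : s.card = Nat.card G - Nat.card (center G) := by
    have := Finset.card_filter_add_card_filter_not (s := (Finset.univ : Finset G)) (· ∈ center G)
    rw [hfin, Nat.card_eq_fintype_card, ← Finset.card_univ]
    exact Nat.eq_sub_of_add_eq' (by convert this)
  rw [ht, ← hs, Finset.card_eq_sum_card_fiberwise (f := fun x => centralizer ({x} : Set G)) (t := t)]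
  · rw [← smul_eq_mul, ← Finset.sum_const]
    refine Finset.sum_congr rfl fun A hA => ?_
    obtain ⟨x, hx, rfl⟩ := (Finset.mem_filter.1 hA).2
    have hnx : n = Nat.card (centralizer ({x} : Set G)) :=
      Nat.mul_self_inj.1 (hn.trans (h.card_sq x hx).symm)
    rw [hnx, hfin, hfin, ← Finset.card_sdiff_of_subset]
    · congr 1
      ext y
      simp only [s, Finset.mem_filter, Finset.mem_univ, true_and, Finset.mem_sdiff]
      constructor
      · rintro ⟨hy, hyx⟩
        exact ⟨hyx ▸ mem_centralizer_singleton_self y, hy⟩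
      · rintro ⟨hyx, hy⟩
        exact ⟨hy, h.eq_of_mem x y hyx hx hy⟩
    · intro y hy
      simp only [Finset.mem_filter, Finset.mem_univ, true_and] at hy ⊢
      exact center_le_centralizer _ hy
  · intro x hx
    have hx' : x ∉ center G := by simpa [s] using hx
    simpa [t] using ⟨x, hx', rfl⟩

theorem card_quotient_center [Finite G] (h : HasCentralizerSpread G) {p : ℕ} (hp : p.Prime)
    (hG : IsPGroup p G) (hnonab : ∃ x y : G, x * y ≠ y * x) :
    ∃ a : ℕ, 0 < a ∧ Nat.card (G ⧸ center G) = p ^ (2 * a) ∧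
      Nat.card {A : Subgroup G | ∃ x ∉ center G, A = centralizer {x}} = p ^ a + 1 := by
  have := Fact.mk hp
  obtain ⟨x, y, hxy⟩ := hnonab
  have hx : x ∉ center G := fun hc => hxy (mem_center_iff.1 hc y).symm
  obtain ⟨k, hk⟩ := IsPGroup.iff_card.1 (hG.to_quotient (center G))
  obtain ⟨m, hm⟩ := card_dvd_of_le (center_le_centralizer ({x} : Set G))
  have hz : 0 < Nat.card (center G) := Nat.card_pos
  have hGc := card_eq_card_quotient_mul_card_subgroup (center G)
  have hsq := h.card_sq x hx
  have hcount := h.card_mul_sub hsq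
  generalize Nat.card {A : Subgroup G | ∃ x ∉ center G, A = centralizer {x}} = w at hcount ⊢
  rw [hk] at hGc
  rw [hm, hGc] at hsq hcount
  generalize Nat.card (center G) = z at *
  have hmm : m * m = p ^ k := by
    apply Nat.eq_of_mul_eq_mul_right (Nat.mul_pos hz hz)
    linarith
  obtain ⟨a, -, rfl⟩ := (Nat.dvd_prime_pow hp).1 (Dvd.intro _ hmm)
  have hka : k = 2 * a := by
    rw [← pow_add] at hmm
    have := Nat.pow_right_injective hp.two_le hmm
    omega
  subst hka
  have ha : a ≠ 0 := by
    rintro rfl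
    apply hx
    have h1 : Nat.card (G ⧸ center G) = 1 := by simpa using hk
    have htop : center G = ⊤ := index_eq_one.1 h1
    rw [htop]
    exact mem_top x
  refine ⟨a, Nat.pos_of_ne_zero ha, hk, ?_⟩
  have hq : 1 < p ^ a := Nat.one_lt_pow ha hp.one_lt
  rw [← hmm] at hcount
  generalize p ^ a = q at *
  obtain ⟨r, rfl⟩ : ∃ r, q = r + 1 := ⟨q - 1, by omega⟩
  have hr : 0 < r := by omega
  -- With `q = r + 1`, this is `(q² - 1)z = (q + 1)(q - 1)z`; the factor `(q - 1)z` then cancels.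
  have e1 : (r + 1) * (r + 1) * z - z = (r + 1 + 1) * (z * r) := by
    rw [Nat.sub_eq_iff_eq_add (Nat.le_mul_of_pos_left _ (by positivity))]; ring
  have e2 : z * (r + 1) - z = z * r := by rw [mul_add, mul_one, Nat.add_sub_cancel]
  rw [e1, e2] at hcount
  exact (Nat.eq_of_mul_eq_mul_right (Nat.mul_pos hz hr) hcount).symm

end HasCentralizerSpread

/-! ### Quasi-antichains of centralizers -/

theorem card_mul_card_centralizer (h : centralizerLattice G = cdLattice G) {H : Subgroup G}
    (hH : H ∈ centralizerLattice G) :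
    Nat.card H * Nat.card (centralizer (H : Set G)) = Nat.card G * Nat.card (center G) := by
  have ht : (⊤ : Subgroup G) ∈ cdLattice G := h ▸ top_mem
  rw [h] at hH
  rw [← measure_top]
  exact le_antisymm (ht H) (hH ⊤)

theorem center_le_of_mem {H : Subgroup G} (hH : H ∈ centralizerLattice G) : center G ≤ H := by
  obtain ⟨K, rfl⟩ := hH
  exact center_le_centralizer _

theorem eq_of_le_of_isQuasiAntichain (h : IsQuasiAntichain (centralizerLattice G))
    {H K : Subgroup G} (hH : H ∈ centralizerLattice G) (hK : K ∈ centralizerLattice G)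
    (hHc : H ≠ center G) (hle : H ≤ K) (hKt : K ≠ ⊤) : H = K := by
  obtain ⟨b, t, hb, ht, hx⟩ := h
  have hbc : (b : Subgroup G) = center G :=
    le_antisymm (hb ⟨_, center_mem⟩) (center_le_of_mem b.2)
  have htt : (t : Subgroup G) = ⊤ := top_le_iff.1 (ht ⟨_, top_mem⟩)
  rcases hx ⟨K, hK⟩ with hk | hk | hk
  · have hKc : K = center G := (congrArg Subtype.val hk).trans hbc
    exact absurd (le_antisymm (hKc ▸ hle) (center_le_of_mem hH)) hHc
  · exact absurd ((congrArg Subtype.val hk).trans htt) hKt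
  · by_contra hne
    refine hk.2 (c := ⟨H, hH⟩) (lt_of_le_of_ne (hb _) fun he => hHc ?_)
      (lt_of_le_of_ne hle fun he => hne (congrArg Subtype.val he))
    exact (congrArg Subtype.val he).symm.trans hbc

/-- The double centralizer of `x` is the least centralizer containing `x`, and a proper one above it
is an atom. -/
theorem eq_centralizer_singleton (h : IsQuasiAntichain (centralizerLattice G))
    {K : Subgroup G} (hK : K ∈ centralizerLattice G) (hKt : K ≠ ⊤) {x : G} (hx : x ∉ center G)
    (hxK : x ∈ K) : centralizer (centralizer ({x} : Set G) : Set G) = K := by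
  refine eq_of_le_of_isQuasiAntichain h (centralizer_mem _) hK (fun he => hx ?_) ?_ hKt
  · rw [← he]
    exact le_centralizer_centralizer {x} rfl
  · obtain ⟨H, rfl⟩ := hK
    rw [← centralizer_centralizer_centralizer (H : Set G)]
    apply centralizer_le
    apply centralizer_le
    simpa using hxK

theorem hasCentralizerSpread (hcd : centralizerLattice G = cdLattice G)
    (h : IsQuasiAntichain (centralizerLattice G)) : HasCentralizerSpread G := by
  have key : ∀ x ∉ center G,
      centralizer (centralizer ({x} : Set G) : Set G) = centralizer {x} := fun x hx =>
    eq_centralizer_singleton h (centralizer_mem _) (mt centralizer_singleton_eq_top.1 hx) hx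
      (mem_centralizer_singleton_self x)
  refine ⟨key, fun x y hy hx hyc => ?_, fun x hx => ?_⟩
  · rw [← key y hyc]
    exact eq_centralizer_singleton h (centralizer_mem _) (mt centralizer_singleton_eq_top.1 hx)
      hyc hy
  · have := card_mul_card_centralizer hcd (centralizer_mem ({x} : Set G))
    rwa [key x hx] at this

theorem centralizerLattice_eq (hcd : centralizerLattice G = cdLattice G)
    (h : IsQuasiAntichain (centralizerLattice G)) :
    centralizerLattice G =
      {⊤, center G} ∪ {A : Subgroup G | ∃ x ∉ center G, A = centralizer {x}} := by
  ext K
  constructor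
  · intro hK
    by_cases hKt : K = ⊤
    · exact Or.inl (Or.inl hKt)
    by_cases hKc : K = center G
    · exact Or.inl (Or.inr hKc)
    obtain ⟨x, hxK, hx⟩ : ∃ x ∈ K, x ∉ center G := by
      by_contra! hle
      exact hKc (le_antisymm hle (center_le_of_mem hK))
    exact Or.inr ⟨x, hx, by rw [← eq_centralizer_singleton h hK hKt hx hxK,
      (hasCentralizerSpread hcd h).self_centralizing x hx]⟩
  · rintro ((rfl | rfl) | ⟨x, -, rfl⟩)
    exacts [top_mem, center_mem, centralizer_mem _]

/-! ### Recovering the Chermak–Delgado lattice from constant measure -/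

theorem measure_le_measure_centralizer [Finite G] (H : Subgroup G) :
    measure H ≤ measure (centralizer (H : Set G)) := by
  rw [measure, measure, mul_comm]
  exact Nat.mul_le_mul_left _ (card_le_of_le (le_centralizer_centralizer (H : Set G)))

theorem centralizerLattice_eq_cdLattice [Finite G]
    (h : ∀ H ∈ centralizerLattice G, measure H = Nat.card G * Nat.card (center G)) :
    centralizerLattice G = cdLattice G := by
  ext H
  constructor
  · intro hH K
    refine (measure_le_measure_centralizer K).trans ?_
    rw [h H hH, h _ (centralizer_mem _)]
  · intro hH
    -- Maximality bounds the order of the double centralizer by that of `H`, so `H` equals it.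
    have h1 : measure (centralizer (H : Set G)) ≤ measure H := hH _
    rw [measure, measure, mul_comm (Nat.card H)] at h1
    have h2 := Nat.le_of_mul_le_mul_left h1 Nat.card_pos
    exact ⟨_, eq_of_le_of_card_ge (le_centralizer_centralizer (H : Set G)) h2⟩

end ChermakDelgado

theorem mainTheorem6 {G : Type*} [Group G] [Finite G] (p : ℕ) (hp : p.Prime)
    (hG : IsPGroup p G) (hnonab : ∃ x y : G, x * y ≠ y * x) :
    (ChermakDelgado.centralizerLattice G = ChermakDelgado.cdLattice G ∧
      ChermakDelgado.IsQuasiAntichain (ChermakDelgado.centralizerLattice G)) ↔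
    (ChermakDelgado.IsNilpotentOfClass G 2 ∧
      ∃ (w : ℕ) (A : Fin w → Subgroup G),
        (Function.Injective A ∧
          ChermakDelgado.centralizerLattice G = {⊤, Subgroup.center G} ∪ Set.range A ∧
          ∀ i, ChermakDelgado.IsMaximalAbelian (A i) ∧
            (Nat.card (A i) : ℝ) =
              Real.sqrt ((Nat.card G : ℝ) * (Nat.card (Subgroup.center G) : ℝ))) ∧
        ∃ a b : ℕ, 0 < a ∧ 0 < b ∧ b ≤ a ∧
          Nat.card (G ⧸ Subgroup.center G) = p ^ (2 * a) ∧ w = p ^ b + 1) := by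
  constructor
  · rintro ⟨hcd, hqa⟩
    have hs := ChermakDelgado.hasCentralizerSpread hcd hqa
    refine ⟨hs.isNilpotentOfClass_two hnonab, ?_⟩
    obtain ⟨a, ha, hcard, hw⟩ := hs.card_quotient_center hp hG hnonab
    let e := (Finite.equivFinOfCardEq hw).symm
    -- The count is exactly `p ^ a + 1`, so `b = a` serves.
    refine ⟨p ^ a + 1, fun i => e i, ⟨Subtype.val_injective.comp e.injective, ?_, fun i => ?_⟩,
      a, a, ha, ha, le_rfl, hcard, rfl⟩
    · rw [ChermakDelgado.centralizerLattice_eq hcd hqa]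
      congr 1
      have := e.surjective.range_comp (Subtype.val : _ → Subgroup G)
      rw [Subtype.range_coe] at this
      exact this.symm
    · obtain ⟨x, hx, hxe⟩ := (e i).2
      simp only [hxe]
      refine ⟨⟨fun u hu v hv => hs.commute hx hu hv, (hs.self_centralizing x hx).symm⟩, ?_⟩
      rw [eq_comm, Real.sqrt_eq_iff_mul_self_eq (by positivity) (by positivity)]
      exact_mod_cast (hs.card_sq x hx).symm
  · rintro ⟨-, w, A, ⟨-, hC, hA⟩, -⟩
    have hcard : ∀ i, Nat.card (A i) * Nat.card (A i) =
        Nat.card G * Nat.card (Subgroup.center G) := fun i => by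
      have := (hA i).2
      rw [eq_comm, Real.sqrt_eq_iff_mul_self_eq (by positivity) (by positivity)] at this
      exact_mod_cast this.symm
    refine ⟨ChermakDelgado.centralizerLattice_eq_cdLattice fun H hH => ?_,
      ⟨_, ChermakDelgado.center_mem⟩, ⟨_, ChermakDelgado.top_mem⟩,
      fun H => ChermakDelgado.center_le_of_mem H.2, fun H => le_top (a := (H : Subgroup G)), ?_⟩
    · rw [hC] at hH
      rcases hH with (rfl | rfl) | ⟨i, rfl⟩
      · exact ChermakDelgado.measure_top
      · rw [ChermakDelgado.measure, Subgroup.centralizer_eq_top_iff_subset.2 subset_rfl,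
          Subgroup.card_top, mul_comm]
      · rw [ChermakDelgado.measure, ← (hA i).1.2, hcard]
    · rintro ⟨H, hH⟩
      have hH' := hH
      rw [hC] at hH'
      rcases hH' with (rfl | rfl) | ⟨i, rfl⟩
      · exact Or.inr (Or.inl rfl)
      · exact Or.inl rfl
      · refine Or.inr (Or.inr ⟨lt_of_le_of_ne (ChermakDelgado.center_le_of_mem hH) ?_, ?_⟩)
        · intro he
          have he' : Subgroup.center G = A i := congrArg Subtype.val he
          have := hcard i
          rw [← he'] at this
          have hc := Nat.eq_of_mul_eq_mul_right Nat.card_pos this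
          obtain ⟨x, y, hxy⟩ := hnonab
          have htop := Subgroup.eq_top_of_card_eq _ hc
          exact hxy (Subgroup.mem_center_iff.1 (htop ▸ Subgroup.mem_top y) x)
        · rintro ⟨K, hK⟩ h1 h2
          have h1' : Subgroup.center G < K := h1
          have h2' : K < A i := h2
          rw [hC] at hK
          rcases hK with (rfl | rfl) | ⟨j, rfl⟩
          · exact absurd le_top h2'.not_ge
          · exact h1'.ne rfl
          -- All `A i` have the same order, so none lies strictly inside another.
          · have hij := Nat.mul_self_inj.1 ((hcard i).trans (hcard j).symm)
            exact h2'.ne (Subgroup.eq_of_le_of_card_ge h2'.le hij.le)
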